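/- **Proposition 4.6.** Let $\mathbb N=\{1,2,\dots\}$. For every limit ordinal $\beta<\omega_1$ fix a sequence of ordinals $\beta_1\le\beta_2\le\cdots<\beta$ with $\sup_n\beta_n=\beta$. Write $n\le F$ if $n\le k$ for all $k\in F$, and $E<F$ if $k<l$ for all $k\in E$, $l\in F$. The Schreier families $S_\alpha$, $\alpha<\omega_1$, of finite subsets of $\mathbb N$ are defined by $$S_0=\{\{n\}:n\in\mathbb N\}\cup\{\varnothing\},$$ $$S_{\alpha+1}=\{\varnothing\}\cup\Big\{\bigcup_{i=1}^m E_i : m\in\mathbb N,\ E_i\in S_\alpha\setminus\{\varnothing\}\text{ for all }i,\ m\le E_1<\dots<E_m\Big\},$$ $$S_\beta=\{F:\ \exists\, n\in\mathbb N\ \text{with}\ n\le F\ \text{and}\ F\in S_{\beta_n}\}\quad\text{for limit ordinals }\beta .$$ The Schreier space $X_\alpha$ is the completion of the space $c_{00}$ of finitely supported real sequences $x=(x_n)_{n\in\mathbb N}$ under the norm $\|x\|_\alpha=\max_{E\in S_\alpha}\sum_{n\in E}|x_n|$. For a real Banach space $X$, a set $K\subset X^*$ and $\varepsilon>0$, let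 $K'_\varepsilon$ be the set of all $z\in K$ such that $\operatorname{diam}(U\cap K)>\varepsilon$ (diameter in the dual norm) for every weak$^*$ neighbourhood $U$ of $z$. Put $P_0(K,\varepsilon)=K$, $P_{\gamma+1}(K,\varepsilon)=(P_\gamma(K,\varepsilon))'_\varepsilon$, and $P_\gamma(K,\varepsilon)=\bigcap_{\delta<\gamma}P_\delta(K,\varepsilon)$ for limit ordinals $\gamma$. Let $\eta(K,\varepsilon)$ be the least $\gamma<\omega_1$ with $P_\gamma(K,\varepsilon)=\varnothing$ if there is one, and $\omega_1$ otherwise. The Szlenk index of $X$ is $Sz(X)=\sup_{\varepsilon>0}\eta(B_{X^*},\varepsilon)$, where $B_{X^*}$ is the closed unit ball of $X^*$. Then, for every choice of the sequences $(\beta_n)$ and for every countable ordinal $\alpha$, $$Sz(X_\alpha)=\omega^{\alpha+1}.$$ -/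

import Mathlib

open scoped Ordinal Topology

noncomputable section

namespace Schreier

/-! ### Schreier families.  The natural numbers are the positive integers `ℕ+`. -/

/-- `a` assigns to every countable limit ordinal `β` a sequence `a β 1 ≤ a β 2 ≤ ...` of ordinals
smaller than `β` which increases to `β`. -/
structure IsApproximation (a : Ordinal.{0} → ℕ+ → Ordinal.{0}) : Prop where
  mono : ∀ β < ω₁, Order.IsSuccLimit β → Monotone (a β)
  lt : ∀ β < ω₁, Order.IsSuccLimit β → ∀ n, a β n < β
  isLUB : ∀ β < ω₁, Order.IsSuccLimit β → IsLUB (Set.range (a β)) β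

/-- The family of all unions `E₁ ∪ ... ∪ Eₘ` with `m ≤ E₁ < ... < Eₘ` and all `Eᵢ` in `S`.
(With `m = 0`, or with empty `Eᵢ`, one obtains the empty set.  Empty `Eᵢ` are harmless,
as `Eᵢ < Eⱼ` is required for all `i < j`, and `m ≤ Eᵢ` for all `i`.) -/
def succFamily (S : Set (Finset ℕ+)) : Set (Finset ℕ+) :=
  {F | ∃ (m : ℕ) (E : Fin m → Finset ℕ+),
    (∀ i, E i ∈ S) ∧
    (∀ i, ∀ k ∈ E i, m ≤ (k : ℕ)) ∧
    (∀ i j, i < j → ∀ k ∈ E i, ∀ l ∈ E j, k < l) ∧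
    F = Finset.univ.biUnion E}

/-- The Schreier family `S_α`, with `a β` as the sequence used at a limit ordinal `β`. -/
def family (a : Ordinal.{0} → ℕ+ → Ordinal.{0}) (α : Ordinal.{0}) : Set (Finset ℕ+) :=
  Ordinal.limitRecOn (motive := fun _ => Set (Finset ℕ+)) α
    ({F | ∃ n : ℕ+, F = {n}} ∪ {∅})
    (fun _ S => succFamily S)
    (fun β _ S => {F | ∃ (n : ℕ+) (h : a β n < β), (∀ k ∈ F, n ≤ k) ∧ F ∈ S (a β n) h})

theorem family_zero (a : Ordinal.{0} → ℕ+ → Ordinal.{0}) :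
    family a 0 = {F | ∃ n : ℕ+, F = {n}} ∪ {∅} := by
  simp [family]

theorem family_add_one (a : Ordinal.{0} → ℕ+ → Ordinal.{0}) (α : Ordinal.{0}) :
    family a (α + 1) = succFamily (family a α) := by
  simp [family]

theorem family_limit {a : Ordinal.{0} → ℕ+ → Ordinal.{0}} (ha : IsApproximation a)
    {β : Ordinal.{0}} (hβ : β < ω₁) (hl : Order.IsSuccLimit β) :
    family a β = {F | ∃ n : ℕ+, (∀ k ∈ F, n ≤ k) ∧ F ∈ family a (a β n)} := by
  ext F
  simp [family, Ordinal.limitRecOn_limit _ _ _ _ hl, ha.lt β hβ hl]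

/-! ### Schreier spaces -/

theorem bddAbove_sum (S : Set (Finset ℕ+)) (x : ℕ+ →₀ ℝ) :
    BddAbove (Set.range fun E : S => ∑ n ∈ E.1, |x n|) := by
  refine ⟨∑ n ∈ x.support, |x n|, ?_⟩
  rintro _ ⟨E, rfl⟩
  show ∑ n ∈ E.1, |x n| ≤ _
  rw [← Finset.sum_filter_add_sum_filter_not E.1 (· ∈ x.support)]
  have h0 : ∑ n ∈ E.1 with n ∉ x.support, |x n| = 0 :=
    Finset.sum_eq_zero fun n hn => by simpa using (Finset.mem_filter.1 hn).2
  rw [h0, add_zero]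
  exact Finset.sum_le_sum_of_subset_of_nonneg (fun n hn => (Finset.mem_filter.1 hn).2)
    fun _ _ _ => abs_nonneg _

/-- The seminorm `‖x‖ = sup {‖Ex‖₁ : E ∈ S}` on `c₀₀`.  The supremum is attained when `S` is not
empty, and this is a norm when `S` contains all singletons, as every Schreier family does. -/
def schreierSeminorm (S : Set (Finset ℕ+)) : Seminorm ℝ (ℕ+ →₀ ℝ) :=
  Seminorm.of (fun x => ⨆ E : S, ∑ n ∈ E.1, |x n|)
    (fun x y => by
      refine Real.iSup_le (fun E => ?_) (add_nonneg
        (Real.iSup_nonneg fun _ => Finset.sum_nonneg fun _ _ => abs_nonneg _)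
        (Real.iSup_nonneg fun _ => Finset.sum_nonneg fun _ _ => abs_nonneg _))
      calc ∑ n ∈ E.1, |(x + y) n| ≤ ∑ n ∈ E.1, (|x n| + |y n|) :=
            Finset.sum_le_sum fun n _ => abs_add_le _ _
        _ = ∑ n ∈ E.1, |x n| + ∑ n ∈ E.1, |y n| := Finset.sum_add_distrib
        _ ≤ _ := add_le_add (le_ciSup (bddAbove_sum S x) E) (le_ciSup (bddAbove_sum S y) E))
    (fun c x => by
      rw [Real.norm_eq_abs, Real.mul_iSup_of_nonneg (abs_nonneg c)]
      simp [Finset.mul_sum, abs_mul])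

/-- The space `c₀₀` of finitely supported real sequences, to be normed by a family `S`. -/
def C00 (_S : Set (Finset ℕ+)) : Type := ℕ+ →₀ ℝ

instance (S : Set (Finset ℕ+)) : AddCommGroup (C00 S) :=
  inferInstanceAs (AddCommGroup (ℕ+ →₀ ℝ))

instance (S : Set (Finset ℕ+)) : Module ℝ (C00 S) :=
  inferInstanceAs (Module ℝ (ℕ+ →₀ ℝ))

instance (S : Set (Finset ℕ+)) : SeminormedAddCommGroup (C00 S) :=
  AddGroupSeminorm.toSeminormedAddCommGroup (E := C00 S) (schreierSeminorm S).toAddGroupSeminorm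

instance (S : Set (Finset ℕ+)) : NormedSpace ℝ (C00 S) where
  norm_smul_le c x := ((schreierSeminorm S).smul' c x).le

theorem norm_def (S : Set (Finset ℕ+)) (x : C00 S) :
    ‖x‖ = ⨆ E : S, ∑ n ∈ E.1, |(show ℕ+ →₀ ℝ from x) n| := rfl

/-- The Schreier space `X_α`: the completion of `c₀₀` under the norm given by `S_α`. -/
abbrev Space (a : Ordinal.{0} → ℕ+ → Ordinal.{0}) (α : Ordinal.{0}) : Type :=
  UniformSpace.Completion (C00 (family a α))

end Schreier

/-! ### The Szlenk index -/

namespace Szlenk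

variable {X : Type*} [NormedAddCommGroup X] [NormedSpace ℝ X]

/-- The derived set `K'_ε`: all `z ∈ K` such that `diam (U ∩ K) > ε` for every weak* neighbourhood
`U` of `z`, the diameter being taken in the dual norm. -/
def deriv (ε : ℝ) (K : Set (WeakDual ℝ X)) : Set (WeakDual ℝ X) :=
  {z ∈ K | ∀ U ∈ 𝓝 z, ENNReal.ofReal ε < Metric.ediam (WeakDual.toStrongDual '' (U ∩ K))}

/-- The iterated derived sets `P_α(K, ε)`. -/
def iterDeriv (K : Set (WeakDual ℝ X)) (ε : ℝ) (α : Ordinal.{0}) : Set (WeakDual ℝ X) :=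
  Ordinal.limitRecOn (motive := fun _ => Set (WeakDual ℝ X)) α
    K
    (fun _ P => deriv ε P)
    (fun β _ P => ⋂ (γ : Ordinal.{0}) (h : γ < β), P γ h)

theorem iterDeriv_zero (K : Set (WeakDual ℝ X)) (ε : ℝ) : iterDeriv K ε 0 = K := by
  simp [iterDeriv]

theorem iterDeriv_add_one (K : Set (WeakDual ℝ X)) (ε : ℝ) (α : Ordinal.{0}) :
    iterDeriv K ε (α + 1) = deriv ε (iterDeriv K ε α) := by
  simp [iterDeriv]

theorem iterDeriv_limit (K : Set (WeakDual ℝ X)) (ε : ℝ) {β : Ordinal.{0}}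
    (hl : Order.IsSuccLimit β) :
    iterDeriv K ε β = ⋂ (γ : Ordinal.{0}) (_ : γ < β), iterDeriv K ε γ := by
  simp [iterDeriv, Ordinal.limitRecOn_limit _ _ _ _ hl]

open Classical in
/-- `η(K, ε)`: the least `α` with `P_α(K, ε) = ∅` if there is such an `α < ω₁`,
and `ω₁` otherwise. -/
def eta (K : Set (WeakDual ℝ X)) (ε : ℝ) : Ordinal.{0} :=
  if ∃ α < ω₁, iterDeriv K ε α = ∅ then sInf {α | iterDeriv K ε α = ∅} else ω₁

/-- The closed unit ball of the dual of `X`, as a set in the weak* dual. -/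
def dualBall (X : Type*) [NormedAddCommGroup X] [NormedSpace ℝ X] : Set (WeakDual ℝ X) :=
  WeakDual.toStrongDual ⁻¹' Metric.closedBall 0 1

/-- The Szlenk index `Sz(X)`, the supremum of `η(B_{X*}, ε)` over all `ε > 0`. -/
def index (X : Type*) [NormedAddCommGroup X] [NormedSpace ℝ X] : Ordinal.{0} :=
  ⨆ ε : {ε : ℝ // 0 < ε}, eta (dualBall X) ε.1

end Szlenk

end

/-!
Derived sets of dual balls are compared across different Schreier spaces, so all of them are moved
into one ambient space, the functions on `c₀₀ = ℕ+ →₀ ℝ` with the topology of pointwise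
convergence.  A functional on the completion is determined by its restriction to `c₀₀`; on the dual
ball the restriction is a homeomorphism onto the set `functionals p 1` of linear maps bounded by
the norm `p`, and it carries the Szlenk derivation to `gaugeDeriv p ε`
(`restrict_mem_transIter_iff`).  Write `p_α` for the norm of `X_α`, `B_α` for its dual ball, and
`P_γ` for the iterates.

*Upper bound.*  Suppose that `f ∈ P_γ(r B_α, ε)` with `γ = ω ^ α` is large at a finitely supported
`x` of norm one, `f x > r - ε / 8`, and let `N` bound the support of `x`.  Then `p_α = max p' q`,
where `p'` comes from the sets in `S_α` which meet `{1, ..., N}` and `q`, which vanishes at `x`,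
from those to the right of `N`.  A Hahn-Banach argument (`exists_functionals_near`) shows that near
`f` every functional in `r B_α` is an `ε / 8`-perturbation of a functional bounded by `r p'`.
Since derivation is local and stable under perturbations (`exists_mem_transIter_of_perturb`), the
dual ball of `p'` would survive `ω ^ α` derivations as well.  This is impossible: a set in `S_α`
which meets `{1, ..., N}` is a union of at most `N` sets in `S_ξ` if `α = ξ + 1`, and belongs to
one of finitely many earlier families if `α` is a limit, so `p' ≤ C p_ξ` for some `ξ < α`
(`exists_schreierSeminorm_meeting_le`), and by induction `P_{ω ^ ξ m}` of any multiple of `B_ξ` is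
empty for some `m`, while `ω ^ ξ m < ω ^ α`.  (For `α = 0`, the dual ball of `p'` is norm compact.)
Hence `P_{ω ^ α}(r B_α, ε) ⊆ (r - ε / 8) B_α`, and finitely many rounds of `ω ^ α` derivations
exhaust the ball.

*Lower bound.*  The functionals `x ↦ ∑ n ∈ F, x n`, for `F ∈ S_α` to the right of any `N`, already
have `0` in their `ω ^ α`-th derived set for `ε = 1 / 2` (`zero_mem_transIter_tail`); in the
successor step, unions of `m` sets of `S_α` survive `ω ^ α m` derivations, one set at a time.
By scaling and translating, `0` survives `ω ^ α m` derivations of `B_α` for `ε = 1 / (2 m)`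
(`zero_mem_transIter_mul`), and `sup_m ω ^ α m = ω ^ (α + 1)`.
-/

open scoped Ordinal Topology

noncomputable section

namespace Szlenk

open Set Filter

/-! ### Transfinite iteration of a set operator -/

section TransIter

variable {V V' : Type*}

/-- The transfinite iterates of a set operator `d`, starting from `K`.  The single clause
`K ∩ ⋂ δ < γ, d (P δ)` covers zero, successor and limit stages at once, provided that
`d` is monotone and `d A ⊆ A`. -/
def transIter (d : Set V → Set V) (K : Set V) (γ : Ordinal.{0}) : Set V :=
  K ∩ ⋂ δ : Iio γ, d (transIter d K δ.1)
termination_by γ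
decreasing_by exact δ.2

theorem mem_transIter {d : Set V → Set V} {K : Set V} {γ : Ordinal.{0}} {z : V} :
    z ∈ transIter d K γ ↔ z ∈ K ∧ ∀ δ < γ, z ∈ d (transIter d K δ) := by
  rw [transIter]
  simp

theorem transIter_subset (d : Set V → Set V) (K : Set V) (γ : Ordinal.{0}) :
    transIter d K γ ⊆ K :=
  fun _ hz => (mem_transIter.1 hz).1

theorem transIter_antitone (d : Set V → Set V) (K : Set V) : Antitone (transIter d K) :=
  fun _ _ h _ hz => mem_transIter.2
    ⟨(mem_transIter.1 hz).1, fun δ hδ => (mem_transIter.1 hz).2 δ (hδ.trans_le h)⟩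

theorem transIter_zero (d : Set V → Set V) (K : Set V) : transIter d K 0 = K := by
  ext z
  simp [mem_transIter]

theorem transIter_add_one {d : Set V → Set V} (hd : Monotone d) (hd' : ∀ A, d A ⊆ A)
    (K : Set V) (γ : Ordinal.{0}) : transIter d K (γ + 1) = d (transIter d K γ) := by
  ext z
  rw [mem_transIter]
  refine ⟨fun h => h.2 γ (Order.lt_add_one_iff.2 le_rfl), fun h => ⟨?_, fun δ hδ => ?_⟩⟩
  · exact transIter_subset d K γ (hd' _ h)
  · exact hd (transIter_antitone d K (Order.lt_add_one_iff.1 hδ)) h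

theorem transIter_one {d : Set V → Set V} (hd : Monotone d) (hd' : ∀ A, d A ⊆ A)
    (K : Set V) : transIter d K 1 = d K := by
  rw [← zero_add 1, transIter_add_one hd hd', transIter_zero]

theorem transIter_add (d : Set V → Set V) (K : Set V) (γ δ : Ordinal.{0}) :
    transIter d K (γ + δ) = transIter d (transIter d K γ) δ := by
  induction δ using WellFoundedLT.induction with
  | _ δ ih =>
  ext z
  rw [mem_transIter, mem_transIter, mem_transIter]
  constructor
  · rintro ⟨h, h'⟩
    refine ⟨⟨h, fun η hη => h' η (hη.trans_le le_self_add)⟩, fun η hη => ?_⟩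
    rw [← ih η hη]
    exact h' _ (by gcongr)
  · rintro ⟨⟨h, h'⟩, h''⟩
    refine ⟨h, fun η hη => ?_⟩
    rcases lt_or_ge η γ with h1 | h1
    · exact h' η h1
    · obtain ⟨ζ, rfl⟩ := exists_add_of_le h1
      have hζ : ζ < δ := lt_of_add_lt_add_left hη
      rw [ih ζ hζ]
      exact h'' ζ hζ

/-- A map which intertwines two set operators maps the iterates of the one into the iterates
of the other. -/
theorem mapsTo_transIter {d : Set V → Set V} {d' : Set V' → Set V'} {φ : V → V'}
    (h : ∀ A A', MapsTo φ A A' → MapsTo φ (d A) (d' A')) {K : Set V} {K' : Set V'}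
    (hK : MapsTo φ K K') (γ : Ordinal.{0}) :
    MapsTo φ (transIter d K γ) (transIter d' K' γ) := by
  induction γ using WellFoundedLT.induction with
  | _ γ ih =>
  intro z hz
  rw [mem_transIter] at hz ⊢
  exact ⟨hK hz.1, fun δ hδ => h _ _ (ih δ hδ) (hz.2 δ hδ)⟩

theorem isClosed_transIter [TopologicalSpace V] {d : Set V → Set V}
    (hd : ∀ A, IsClosed A → IsClosed (d A)) {K : Set V} (hK : IsClosed K) (γ : Ordinal.{0}) :
    IsClosed (transIter d K γ) := by
  induction γ using WellFoundedLT.induction with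
  | _ γ ih =>
  rw [transIter]
  exact hK.inter (isClosed_iInter fun δ => hd _ (ih δ.1 δ.2))

end TransIter

/-! ### Derived sets in the space of functions -/

section GaugeDeriv

variable {E : Type*} [AddCommGroup E] [Module ℝ E]

/-- The analogue of `Szlenk.deriv` for sets of real functions on `E` with the topology of pointwise
convergence: the points of `K` all of whose neighbourhoods in `K` have diameter greater than `ε`
for the (extended) norm dual to the seminorm `p`.  The testing vectors `x` are not normalized,
so that one may pass to another seminorm even if the functions in `K` are not homogeneous. -/
def gaugeDeriv (p : Seminorm ℝ E) (ε : ℝ) (K : Set (E → ℝ)) : Set (E → ℝ) :=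
  {z ∈ K | ∀ U ∈ 𝓝 z, ∃ u ∈ U ∩ K, ∃ v ∈ U ∩ K, ∃ x, ε * p x < u x - v x}

theorem gaugeDeriv_subset (p : Seminorm ℝ E) (ε : ℝ) (K : Set (E → ℝ)) : gaugeDeriv p ε K ⊆ K :=
  fun _ h => h.1

/-- An affine map with linear part a homothety of ratio `s` multiplies diameters by `s`. -/
theorem mapsTo_gaugeDeriv_affine (p : Seminorm ℝ E) (ε : ℝ) (w : E → ℝ) {s : ℝ} (hs : 0 < s)
    {A A' : Set (E → ℝ)} (h : MapsTo (fun u => w + s • u) A A') :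
    MapsTo (fun u => w + s • u) (gaugeDeriv p ε A) (gaugeDeriv p (s * ε) A') := by
  rintro z ⟨hz, hz'⟩
  refine ⟨h hz, fun U hU => ?_⟩
  have hc : Continuous fun u : E → ℝ => w + s • u := by fun_prop
  obtain ⟨u, hu, v, hv, x, hlt⟩ := hz' _ (hc.continuousAt.preimage_mem_nhds hU)
  refine ⟨_, ⟨hu.1, h hu.2⟩, _, ⟨hv.1, h hv.2⟩, x, ?_⟩
  simp only [Pi.add_apply, Pi.smul_apply, smul_eq_mul]
  nlinarith

theorem gaugeDeriv_subset_gaugeDeriv {p q : Seminorm ℝ E} {ε η : ℝ}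
    (hqp : ∀ x, η * q x ≤ ε * p x) {A A' : Set (E → ℝ)} (h : A ⊆ A') :
    gaugeDeriv p ε A ⊆ gaugeDeriv q η A' := by
  rintro z ⟨hz, hz'⟩
  refine ⟨h hz, fun U hU => ?_⟩
  obtain ⟨u, hu, v, hv, x, hlt⟩ := hz' U hU
  exact ⟨u, ⟨hu.1, h hu.2⟩, v, ⟨hv.1, h hv.2⟩, x, (hqp x).trans_lt hlt⟩

theorem gaugeDeriv_mono (p : Seminorm ℝ E) (ε : ℝ) : Monotone (gaugeDeriv p ε) :=
  fun _ _ h => gaugeDeriv_subset_gaugeDeriv (fun _ => le_rfl) h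

theorem isClosed_gaugeDeriv (p : Seminorm ℝ E) (ε : ℝ) (K : Set (E → ℝ)) (hK : IsClosed K) :
    IsClosed (gaugeDeriv p ε K) := by
  rw [← isOpen_compl_iff, isOpen_iff_mem_nhds]
  intro z hz
  by_cases hzK : z ∈ K
  · obtain ⟨U, hU, hU'⟩ : ∃ U ∈ 𝓝 z,
        ¬ ∃ u ∈ U ∩ K, ∃ v ∈ U ∩ K, ∃ x, ε * p x < u x - v x := by
      by_contra! h
      exact hz ⟨hzK, h⟩
    filter_upwards [eventually_mem_nhds_iff.2 hU] with w hw hw'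
    exact hU' (hw'.2 U hw)
  · filter_upwards [hK.isOpen_compl.mem_nhds hzK] with w hw hw'
    exact hw hw'.1

theorem transIter_gaugeDeriv_subset {p q : Seminorm ℝ E} {ε η : ℝ}
    (hqp : ∀ x, η * q x ≤ ε * p x) {A A' : Set (E → ℝ)} (h : A ⊆ A') (γ : Ordinal.{0}) :
    transIter (gaugeDeriv p ε) A γ ⊆ transIter (gaugeDeriv q η) A' γ :=
  mapsTo_transIter (φ := id) (fun _ _ h => gaugeDeriv_subset_gaugeDeriv hqp h) h γ

theorem transIter_gaugeDeriv_affine (p : Seminorm ℝ E) (ε : ℝ) (w : E → ℝ) {s : ℝ} (hs : 0 < s)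
    {A A' : Set (E → ℝ)} (h : MapsTo (fun u => w + s • u) A A') (γ : Ordinal.{0}) :
    MapsTo (fun u => w + s • u) (transIter (gaugeDeriv p ε) A γ)
      (transIter (gaugeDeriv p (s * ε)) A' γ) :=
  mapsTo_transIter (fun _ _ h => mapsTo_gaugeDeriv_affine p ε w hs h) h γ

/-- Derived sets are local. -/
theorem mem_transIter_inter_of_isOpen {p : Seminorm ℝ E} {ε : ℝ} {A U : Set (E → ℝ)}
    (hU : IsOpen U) {γ : Ordinal.{0}} {z : E → ℝ} (hz : z ∈ transIter (gaugeDeriv p ε) A γ)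
    (hzU : z ∈ U) : z ∈ transIter (gaugeDeriv p ε) (A ∩ U) γ := by
  induction γ using WellFoundedLT.induction generalizing z with
  | _ γ ih =>
  rw [mem_transIter] at hz ⊢
  refine ⟨⟨hz.1, hzU⟩, fun δ hδ => ⟨ih δ hδ (hz.2 δ hδ).1 hzU, fun W hW => ?_⟩⟩
  obtain ⟨u, hu, v, hv, hx⟩ := (hz.2 δ hδ).2 _ (inter_mem hW (hU.mem_nhds hzU))
  exact ⟨u, ⟨hu.1.1, ih δ hδ hu.2 hu.1.2⟩, v, ⟨hv.1.1, ih δ hδ hv.2 hv.1.2⟩, hx⟩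

/-- A perturbation by at most `c` in the dual norm changes `ε` into `ε / 2 - 2 * c`.  The factor
`1 / 2` is lost only once, because `ε` is never changed on the perturbed side. -/
theorem exists_mem_transIter_of_perturb {p : Seminorm ℝ E} {ε c : ℝ} {A K : Set (E → ℝ)}
    (hK : IsCompact K) (h : ∀ g ∈ A, ∃ g' ∈ K, ∀ x, |g x - g' x| ≤ c * p x) (γ : Ordinal.{0})
    {g : E → ℝ} (hg : g ∈ transIter (gaugeDeriv p ε) A γ) :
    ∃ g' ∈ transIter (gaugeDeriv p (ε / 2 - 2 * c)) K γ, ∀ x, |g x - g' x| ≤ c * p x := by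
  induction γ using WellFoundedLT.induction generalizing g with
  | _ γ ih =>
  set T := transIter (gaugeDeriv p (ε / 2 - 2 * c)) K with hT
  have hTcl : ∀ δ, IsClosed (T δ) := isClosed_transIter (isClosed_gaugeDeriv _ _) hK.isClosed
  have hBcl : IsClosed {g' : E → ℝ | ∀ x, |g x - g' x| ≤ c * p x} := by
    simp only [Set.ofPred_forall]
    exact isClosed_iInter fun x => isClosed_le (by fun_prop) continuous_const
  have key : ∀ δ < γ, ∃ g' ∈ T (δ + 1), ∀ x, |g x - g' x| ≤ c * p x := by
    intro δ hδ
    rw [hT, transIter_add_one (gaugeDeriv_mono _ _) (gaugeDeriv_subset _ _)]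
    obtain ⟨hgδ, hgd⟩ := (mem_transIter.1 hg).2 δ hδ
    choose! φ hφT hφ using fun (u : E → ℝ) (hu : u ∈ transIter (gaugeDeriv p ε) A δ) =>
      ih δ hδ hu
    let S : Set (E → ℝ) := {u ∈ transIter (gaugeDeriv p ε) A δ | ∃ x, ε / 2 * p x < |u x - g x|}
    have hne : (𝓝 g ⊓ 𝓟 S).NeBot := by
      refine mem_closure_iff_clusterPt.1 (mem_closure_iff_nhds.2 ?_)
      intro U hU
      obtain ⟨u, hu, v, hv, x, hlt⟩ := hgd U hU
      rcases lt_or_ge (ε / 2 * p x) |u x - g x| with h1 | h1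
      · exact ⟨u, hu.1, hu.2, x, h1⟩
      · refine ⟨v, hv.1, hv.2, x, ?_⟩
        have := le_abs_self (u x - g x)
        have := neg_abs_le (v x - g x)
        linarith
    let l := Ultrafilter.of (𝓝 g ⊓ 𝓟 S)
    have hl : (l : Filter (E → ℝ)) ≤ 𝓝 g ⊓ 𝓟 S := Ultrafilter.of_le _
    have hlS : ∀ᶠ u in (l : Filter (E → ℝ)), u ∈ S := hl (mem_inf_of_right (mem_principal_self S))
    have hlg : Tendsto id (l : Filter (E → ℝ)) (𝓝 g) := hl.trans inf_le_left
    obtain ⟨g', hg'K, hg'⟩ := (hK.of_isClosed_subset (hTcl δ) (transIter_subset _ _ _)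
      ).ultrafilter_le_nhds (l.map φ) (by
        rw [le_principal_iff]
        exact hlS.mono fun u hu => hφT u hu.1)
    have hlφ : Tendsto φ (l : Filter (E → ℝ)) (𝓝 g') := hg'
    have hgg' : ∀ x, |g x - g' x| ≤ c * p x := fun x => by
      have h1 : Tendsto (fun u : E → ℝ => |u x - φ u x|) l (𝓝 |g x - g' x|) :=
        ((tendsto_pi_nhds.1 hlg x).sub (tendsto_pi_nhds.1 hlφ x)).abs
      exact le_of_tendsto h1 (hlS.mono fun u hu => hφ u hu.1 x)
    refine ⟨g', ⟨hg'K, fun U hU => ?_⟩, hgg'⟩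
    obtain ⟨u, huU, huS, x, hx⟩ := ((hlφ.eventually_mem hU).and hlS).exists
    have h1 := abs_le.1 (hφ u huS x)
    have h2 := abs_le.1 (hgg' x)
    have hg'U : g' ∈ U ∩ T δ := ⟨mem_of_mem_nhds hU, hg'K⟩
    rcases lt_abs.1 hx with h3 | h3
    · exact ⟨φ u, ⟨huU, hφT u huS⟩, g', hg'U, x, by linarith⟩
    · exact ⟨g', hg'U, φ u, ⟨huU, hφT u huS⟩, x, by linarith⟩
  rcases eq_or_ne γ 0 with rfl | hγ
  · rw [hT, transIter_zero]
    exact h g (transIter_subset _ _ _ hg)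
  have : Nonempty (Iio γ) := ⟨⟨0, pos_iff_ne_zero.2 hγ⟩⟩
  have hanti : Antitone T := transIter_antitone _ _
  obtain ⟨g', hg'⟩ := IsCompact.nonempty_iInter_of_directed_nonempty_isCompact_isClosed
    (fun δ : Iio γ => T (δ.1 + 1) ∩ {g' : E → ℝ | ∀ x, |g x - g' x| ≤ c * p x})
    (Antitone.directed_ge fun δ δ' (hδ : δ.1 ≤ δ'.1) =>
      inter_subset_inter_left _ (hanti (by gcongr)))
    (fun δ => key δ.1 δ.2)
    (fun δ => (hK.of_isClosed_subset (hTcl _) (transIter_subset _ _ _)).inter_right hBcl)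
    (fun δ => (hTcl _).inter hBcl)
  rw [mem_iInter] at hg'
  refine ⟨g', mem_transIter.2 ⟨transIter_subset _ _ _ (hg' (Classical.arbitrary _)).1,
    fun δ hδ => ?_⟩, (hg' (Classical.arbitrary _)).2⟩
  rw [← transIter_add_one (gaugeDeriv_mono _ _) (gaugeDeriv_subset _ _)]
  exact (hg' ⟨δ, hδ⟩).1

end GaugeDeriv

/-! ### Linear functionals bounded by a seminorm -/

section Functionals

variable {E : Type*} [AddCommGroup E] [Module ℝ E]

/-- The ball of radius `R` of the dual of `(E, p)`, as a set of functions on `E`. -/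
def functionals (p : Seminorm ℝ E) (R : ℝ) : Set (E → ℝ) :=
  {f | IsLinearMap ℝ f ∧ ∀ x, f x ≤ R * p x}

theorem abs_le_of_mem_functionals {p : Seminorm ℝ E} {R : ℝ} {f : E → ℝ}
    (hf : f ∈ functionals p R) (x : E) : |f x| ≤ R * p x := by
  refine abs_le.2 ⟨?_, hf.2 x⟩
  have := hf.2 (-x)
  rw [hf.1.map_neg, map_neg_eq_map] at this
  linarith

theorem functionals_subset {p q : Seminorm ℝ E} {R S : ℝ} (h : ∀ x, R * p x ≤ S * q x) :
    functionals p R ⊆ functionals q S :=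
  fun _ hf => ⟨hf.1, fun x => (hf.2 x).trans (h x)⟩

theorem isCompact_functionals (p : Seminorm ℝ E) (R : ℝ) : IsCompact (functionals p R) := by
  refine (isCompact_univ_pi fun x => isCompact_Icc (a := -(R * p x)) (b := R * p x)
    ).of_isClosed_subset ?_ fun f hf x _ => abs_le.1 (abs_le_of_mem_functionals hf x)
  have h : functionals p R = (⋂ (x) (y), {f : E → ℝ | f (x + y) = f x + f y}) ∩
      (⋂ (c : ℝ) (x), {f : E → ℝ | f (c • x) = c • f x}) ∩ ⋂ x, {f : E → ℝ | f x ≤ R * p x} := by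
    ext f
    simp only [functionals, mem_ofPred_eq, mem_inter_iff, mem_iInter]
    exact ⟨fun h => ⟨⟨h.1.map_add, h.1.map_smul⟩, h.2⟩, fun h => ⟨⟨h.1.1, h.1.2⟩, h.2⟩⟩
  rw [h]
  refine ((isClosed_iInter fun x => isClosed_iInter fun y => isClosed_eq ?_ ?_).inter
    (isClosed_iInter fun c => isClosed_iInter fun x => isClosed_eq ?_ ?_)).inter
    (isClosed_iInter fun x => isClosed_le ?_ ?_) <;> fun_prop

/-- If `f ≤ r * max p q` almost attains its bound at a vector on which `q` vanishes, then `f` is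
close to a functional dominated by `p`: extend `(x, x) ↦ f x` from the diagonal to a functional
`(x, y) ↦ g x + h y` on the product dominated by `r * max (p x) (q y)`; then `h` is small. -/
theorem exists_functionals_near {p q : Seminorm ℝ E} {r c : ℝ} (hr : 0 ≤ r) {f : E → ℝ}
    (hf : IsLinearMap ℝ f) (hfr : ∀ x, f x ≤ r * max (p x) (q x)) {x : E} (hq : q x = 0)
    (hx : (r - c) * p x < f x) : ∃ g ∈ functionals p r, f - g ∈ functionals q c := by
  let N : Seminorm ℝ (E × E) := p.comp (LinearMap.fst ℝ E E) ⊔ q.comp (LinearMap.snd ℝ E E)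
  have hN : ∀ z : E × E, N z = max (p z.1) (q z.2) := fun z => rfl
  let D : (E × E) →ₗ.[ℝ] ℝ :=
    { domain := LinearMap.range (LinearMap.id.prod LinearMap.id : E →ₗ[ℝ] E × E)
      toFun := (hf.mk' f).comp ((LinearMap.fst ℝ E E).comp (Submodule.subtype _)) }
  obtain ⟨G, hGD, hG⟩ := exists_extension_of_le_sublinear D (fun z => r * N z)
    (fun t ht z => by
      rw [map_smul_eq_mul, Real.norm_of_nonneg ht.le]
      ring)
    (fun z w => by
      rw [← mul_add]
      exact mul_le_mul_of_nonneg_left (map_add_le_add N z w) hr)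
    (by
      rintro ⟨_, z, rfl⟩
      exact hfr z)
  have hGf : ∀ z, G (z, z) = f z := fun z => hGD ⟨(z, z), z, rfl⟩
  have hGadd : ∀ z w, G (z, 0) + G (0, w) = G (z, w) := fun z w => by
    rw [← map_add, Prod.mk_add_mk, add_zero, zero_add]
  have hpx : 0 < p x := by
    refine (apply_nonneg p x).lt_of_ne fun h => ?_
    have := hfr x
    simp only [← h, hq, max_self, mul_zero] at this hx
    exact hx.not_ge this
  have hgx : (r - c) * p x < G (x, 0) := by
    have h1 := hG (0, x)
    simp only [hN, hq, map_zero, max_self, mul_zero] at h1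
    have h2 := hGadd x x
    rw [hGf] at h2
    linarith
  refine ⟨fun z => G (z, 0), ⟨((G.comp (LinearMap.inl ℝ E E)).isLinear), fun z => ?_⟩, ?_, ?_⟩
  · simpa [hN] using hG (z, 0)
  · have h : f - (fun z => G (z, 0)) = G.comp (LinearMap.inr ℝ E E) := by
      ext z
      have := hGadd z z
      rw [hGf] at this
      simp [← this]
    rw [h]
    exact LinearMap.isLinear _
  · intro y
    have hy : (f - fun z => G (z, 0)) y = G (0, y) := by
      have := hGadd y y
      rw [hGf] at this
      simp [← this]
    rw [hy]
    rcases (apply_nonneg q y).eq_or_lt with h0 | h0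
    · have := hG (0, y)
      simpa [hN, ← h0] using this
    · -- test the bound on `G` at `(q y • x, p x • y)`, where both seminorms have the same value
      have h1 := hG (q y • x, p x • y)
      rw [← hGadd] at h1
      have h2 : G (q y • x, 0) = q y * G (x, 0) := by
        rw [← smul_eq_mul, ← map_smul, Prod.smul_mk, smul_zero]
      have h3 : G (0, p x • y) = p x * G (0, y) := by
        rw [← smul_eq_mul, ← map_smul, Prod.smul_mk, smul_zero]
      have h4 : N (q y • x, p x • y) = q y * p x := by
        rw [hN]
        simp [map_smul_eq_mul, abs_of_pos h0, abs_of_pos hpx, mul_comm]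
      rw [h2, h3, h4] at h1
      have h5 := mul_lt_mul_of_pos_left hgx h0
      refine le_of_mul_le_mul_left ?_ hpx
      linarith

/-- If every vector `x` admits a splitting of `p` into a part `p'` whose dual balls vanish after
`γ` derivations and a part `q` which does not see `x`, then `γ` derivations shrink the dual balls
of `p` by a fixed amount: a functional which is large at `x` has a neighbourhood in which
functionals are small perturbations of functionals dominated by `p'`. -/
theorem transIter_functionals_subset {p : Seminorm ℝ E} {ε : ℝ} (hε : 0 < ε) {γ : Ordinal.{0}}
    (h : ∀ x : E, ∃ p' q : Seminorm ℝ E, p' ≤ p ∧ q ≤ p ∧ p ≤ p' ⊔ q ∧ q x = 0 ∧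
      ∀ η > 0, ∀ r, transIter (gaugeDeriv p η) (functionals p' r) γ = ∅)
    {r : ℝ} (hr : 0 ≤ r) :
    transIter (gaugeDeriv p ε) (functionals p r) γ ⊆ functionals p (r - ε / 8) := by
  intro f hf
  have hfp := transIter_subset _ _ _ hf
  refine ⟨hfp.1, fun x => ?_⟩
  by_contra! hx
  obtain ⟨p', q, hp', hq, hpq, hqx, hempty⟩ := h x
  have hU : IsOpen {g : E → ℝ | (r - ε / 8) * p x < g x} :=
    isOpen_lt continuous_const (continuous_apply x)
  have hpx : p' x = p x := le_antisymm (hp' x) <| by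
    have := hpq x
    rw [Seminorm.sup_apply, hqx] at this
    simpa using this
  obtain ⟨f', hf', -⟩ := exists_mem_transIter_of_perturb (c := ε / 8)
    (isCompact_functionals p' r) (fun g hg => by
      obtain ⟨g', hg', hgg'⟩ := exists_functionals_near (p := p') (q := q) hr hg.1.1
        (fun z => (hg.1.2 z).trans (mul_le_mul_of_nonneg_left (hpq z) hr)) hqx
        (by rw [hpx]; exact hg.2)
      exact ⟨g', hg', fun z => (abs_le_of_mem_functionals hgg' z).trans
        (mul_le_mul_of_nonneg_left (hq z) (by positivity))⟩) γ
    (mem_transIter_inter_of_isOpen hU hf hx)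
  rw [hempty _ (by linarith)] at hf'
  exact hf'

theorem functionals_eq_empty {p : Seminorm ℝ E} (hp : p ≠ 0) {r : ℝ} (hr : r < 0) :
    functionals p r = ∅ := by
  obtain ⟨x, hx⟩ : ∃ x, p x ≠ 0 := by
    by_contra! h
    exact hp (Seminorm.ext h)
  refine eq_empty_of_forall_notMem fun f hf => ?_
  have h1 := (abs_nonneg _).trans (abs_le_of_mem_functionals hf x)
  have h2 : 0 < p x := (apply_nonneg p x).lt_of_ne' hx
  nlinarith

theorem exists_transIter_functionals_eq_empty {p : Seminorm ℝ E} (hp : p ≠ 0) {ε c : ℝ}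
    (hc : 0 < c) {γ : Ordinal.{0}}
    (h : ∀ r ≥ 0, transIter (gaugeDeriv p ε) (functionals p r) γ ⊆ functionals p (r - c)) (r : ℝ) :
    ∃ m : ℕ, transIter (gaugeDeriv p ε) (functionals p r) (γ * m) = ∅ := by
  have key : ∀ m : ℕ,
      transIter (gaugeDeriv p ε) (functionals p r) (γ * m) ⊆ functionals p (r - m * c) := by
    intro m
    induction m with
    | zero => simp [transIter_zero]
    | succ m ih =>
      rw [Nat.cast_succ, mul_add_one, transIter_add]
      rcases lt_or_ge (r - m * c) 0 with h0 | h0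
      · rw [functionals_eq_empty hp h0, subset_empty_iff] at ih
        rw [ih]
        exact (transIter_subset _ _ _).trans (empty_subset _)
      · refine (transIter_gaugeDeriv_subset (fun _ => le_rfl) ih γ).trans ((h _ h0).trans_eq ?_)
        congr 1
        push_cast
        ring
  obtain ⟨m, hm⟩ := exists_nat_gt (r / c)
  refine ⟨m, subset_empty_iff.1 ((key m).trans_eq (functionals_eq_empty hp ?_))⟩
  rw [div_lt_iff₀ hc] at hm
  linarith

/-- If `0` survives `γ` derivations of the dual unit ball for some `ε`, then it survives `γ * N`
derivations for `ε / N`: the ball of radius `1 - (j + 1) / N` is covered by the centres of small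
copies of the unit ball inside the ball of radius `1 - j / N`. -/
theorem zero_mem_transIter_mul {p : Seminorm ℝ E} {ε : ℝ} {γ : Ordinal.{0}}
    (h : 0 ∈ transIter (gaugeDeriv p ε) (functionals p 1) γ) {N : ℕ} (hN : N ≠ 0) :
    0 ∈ transIter (gaugeDeriv p ((N : ℝ)⁻¹ * ε)) (functionals p 1) (γ * N) := by
  have hN' : (0 : ℝ) < (N : ℝ)⁻¹ := by positivity
  have key : ∀ j : ℕ, functionals p (1 - j * (N : ℝ)⁻¹) ⊆
      transIter (gaugeDeriv p ((N : ℝ)⁻¹ * ε)) (functionals p 1) (γ * j) := by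
    intro j
    induction j with
    | zero => simp [transIter_zero]
    | succ j ih =>
      intro z hz
      rw [Nat.cast_succ, mul_add_one, transIter_add]
      refine transIter_gaugeDeriv_subset (fun _ => le_rfl) ih γ ?_
      have := transIter_gaugeDeriv_affine p ε z hN'
        (A' := functionals p (1 - j * (N : ℝ)⁻¹)) (fun u hu => ⟨?_, fun x => ?_⟩) γ h
      · simpa using this
      · exact ((hz.1.mk' z) + (N : ℝ)⁻¹ • (hu.1.mk' u)).isLinear
      · have h1 := hz.2 x
        have h2 := mul_le_mul_of_nonneg_left (hu.2 x) hN'.le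
        simp only [Pi.add_apply, Pi.smul_apply, smul_eq_mul]
        push_cast at h1
        linarith
  refine key N ⟨(0 : E →ₗ[ℝ] ℝ).isLinear, fun x => ?_⟩
  rw [mul_inv_cancel₀ (by positivity)]
  simp

end Functionals
end Szlenk

namespace Schreier

open Set Szlenk

/-! ### Norms given by families of finite sets -/

section Seminorm

variable {S T : Set (Finset ℕ+)} {x : ℕ+ →₀ ℝ}

theorem sum_le_schreierSeminorm {F : Finset ℕ+} (hF : F ∈ S) (x : ℕ+ →₀ ℝ) :
    ∑ n ∈ F, |x n| ≤ schreierSeminorm S x :=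
  le_ciSup (bddAbove_sum S x) ⟨F, hF⟩

theorem schreierSeminorm_le {c : ℝ} (hc : 0 ≤ c) (h : ∀ F ∈ S, ∑ n ∈ F, |x n| ≤ c) :
    schreierSeminorm S x ≤ c :=
  Real.iSup_le (fun F => h F.1 F.2) hc

theorem schreierSeminorm_mono (h : S ⊆ T) : schreierSeminorm S ≤ schreierSeminorm T :=
  fun _ => schreierSeminorm_le (apply_nonneg _ _) fun _ hF => sum_le_schreierSeminorm (h hF) _

theorem abs_le_schreierSeminorm {n : ℕ+} (hn : {n} ∈ S) (x : ℕ+ →₀ ℝ) :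
    |x n| ≤ schreierSeminorm S x := by
  simpa using sum_le_schreierSeminorm hn x

theorem schreierSeminorm_eq_zero (h : ∀ F ∈ S, ∀ n ∈ F, x n = 0) : schreierSeminorm S x = 0 :=
  le_antisymm (schreierSeminorm_le le_rfl fun F hF =>
    (Finset.sum_eq_zero fun n hn => by simp [h F hF n hn]).le) (apply_nonneg _ _)

end Seminorm

/-! ### Combinatorics of the Schreier families -/

variable {a : Ordinal.{0} → ℕ+ → Ordinal.{0}}

theorem family_subset_family_add_one (α : Ordinal.{0}) : family a α ⊆ family a (α + 1) := by
  intro F hF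
  rw [family_add_one]
  exact ⟨1, fun _ => F, fun _ => hF, fun _ k _ => k.2,
    fun i j hij => absurd hij (by simp [Subsingleton.elim i j]), by simp⟩

theorem mem_family_of_subset (ha : IsApproximation a) {α : Ordinal.{0}} (hα : α < ω₁)
    {F G : Finset ℕ+} (hF : F ∈ family a α) (hG : G ⊆ F) : G ∈ family a α := by
  induction α using Ordinal.limitRecOn generalizing F G with
  | zero =>
    rw [family_zero] at hF ⊢
    rcases hF with ⟨n, rfl⟩ | rfl
    · rcases Finset.subset_singleton_iff.1 hG with rfl | rfl
      · exact Or.inr rfl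
      · exact Or.inl ⟨n, rfl⟩
    · rw [Finset.subset_empty.1 hG]
      exact Or.inr rfl
  | add_one α ih =>
    rw [family_add_one] at hF ⊢
    obtain ⟨m, E, hE, hm, hlt, rfl⟩ := hF
    refine ⟨m, fun i => E i ∩ G, fun i => ih ((Order.lt_add_one_iff.2 le_rfl).trans hα) (hE i)
      Finset.inter_subset_left, fun i k hk => hm i k (Finset.mem_of_mem_inter_left hk),
      fun i j hij k hk l hl => hlt i j hij k (Finset.mem_of_mem_inter_left hk) l
        (Finset.mem_of_mem_inter_left hl), ?_⟩
    ext k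
    have := @hG k
    simp only [Finset.mem_biUnion, Finset.mem_univ, true_and, Finset.mem_inter] at this ⊢
    exact ⟨fun hk => (this hk).imp fun i hi => ⟨hi, hk⟩, fun ⟨i, hi⟩ => hi.2⟩
  | limit β hl ih =>
    rw [family_limit ha hα hl] at hF ⊢
    obtain ⟨n, hn, hF⟩ := hF
    exact ⟨n, fun k hk => hn k (hG hk),
      ih _ (ha.lt β hα hl n) ((ha.lt β hα hl n).trans hα) hF hG⟩

theorem singleton_mem_family (ha : IsApproximation a) {α : Ordinal.{0}} (hα : α < ω₁) (n : ℕ+) :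
    {n} ∈ family a α := by
  induction α using Ordinal.limitRecOn with
  | zero =>
    rw [family_zero]
    exact Or.inl ⟨n, rfl⟩
  | add_one α ih =>
    exact family_subset_family_add_one α (ih ((Order.lt_add_one_iff.2 le_rfl).trans hα))
  | limit β hl ih =>
    rw [family_limit ha hα hl]
    exact ⟨1, fun k _ => one_le, ih _ (ha.lt β hα hl 1) ((ha.lt β hα hl 1).trans hα)⟩

theorem empty_mem_family (ha : IsApproximation a) {α : Ordinal.{0}} (hα : α < ω₁) :
    ∅ ∈ family a α :=
  mem_family_of_subset ha hα (singleton_mem_family ha hα 1) (Finset.empty_subset _)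

theorem exists_lt_approximation (ha : IsApproximation a) {β : Ordinal.{0}} (hβ : β < ω₁)
    (hl : Order.IsSuccLimit β) {ξ : Ordinal.{0}} (hξ : ξ < β) : ∃ n, ξ < a β n := by
  obtain ⟨_, ⟨n, rfl⟩, h⟩ := (lt_isLUB_iff (ha.isLUB β hβ hl)).1 hξ
  exact ⟨n, h⟩

/-- The norms increase with the index, up to constants.  (The families themselves do not increase:
at a limit stage only the sets to the right of some `n` are kept.) -/
theorem exists_schreierSeminorm_le (ha : IsApproximation a) {ξ ζ : Ordinal.{0}} (hξ : ξ ≤ ζ)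
    (hζ : ζ < ω₁) :
    ∃ C > 0, ∀ x, schreierSeminorm (family a ξ) x ≤ C * schreierSeminorm (family a ζ) x := by
  induction ζ using Ordinal.limitRecOn with
  | zero =>
    obtain rfl : ξ = 0 := le_antisymm hξ bot_le
    exact ⟨1, one_pos, fun x => by rw [one_mul]⟩
  | add_one ζ ih =>
    rcases hξ.eq_or_lt with rfl | hξ
    · exact ⟨1, one_pos, fun x => by rw [one_mul]⟩
    obtain ⟨C, hC, h⟩ := ih (Order.lt_add_one_iff.1 hξ) ((Order.lt_add_one_iff.2 le_rfl).trans hζ)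
    exact ⟨C, hC, fun x => (h x).trans (mul_le_mul_of_nonneg_left
      (schreierSeminorm_mono (family_subset_family_add_one ζ) x) hC.le)⟩
  | limit β hl ih =>
    rcases hξ.eq_or_lt with rfl | hξ
    · exact ⟨1, one_pos, fun x => by rw [one_mul]⟩
    obtain ⟨n, hn⟩ := exists_lt_approximation ha hζ hl hξ
    have hnβ := ha.lt β hζ hl n
    obtain ⟨C, hC, h⟩ := ih _ hnβ hn.le (hnβ.trans hζ)
    refine ⟨C * (n + 1), by positivity, fun x => (h x).trans ?_⟩
    rw [mul_assoc]
    refine mul_le_mul_of_nonneg_left (schreierSeminorm_le (by positivity) fun F hF => ?_) hC.le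
    rw [← Finset.sum_filter_add_sum_filter_not F (· ≤ n), add_one_mul]
    refine add_le_add ?_ (sum_le_schreierSeminorm ?_ x)
    · calc ∑ k ∈ F with k ≤ n, |x k| ≤ ∑ k ∈ Finset.Icc 1 n, |x k| :=
            Finset.sum_le_sum_of_subset_of_nonneg
              (fun k hk => Finset.mem_Icc.2 ⟨one_le, (Finset.mem_filter.1 hk).2⟩)
              fun _ _ _ => abs_nonneg _
        _ ≤ ∑ k ∈ Finset.Icc 1 n, schreierSeminorm (family a β) x :=
            Finset.sum_le_sum fun k _ => abs_le_schreierSeminorm (singleton_mem_family ha hζ k) x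
        _ = n * schreierSeminorm (family a β) x := by simp
    · rw [family_limit ha hζ hl]
      refine ⟨n, fun k hk => (not_le.1 (Finset.mem_filter.1 hk).2).le, ?_⟩
      exact mem_family_of_subset ha (hnβ.trans hζ) hF (Finset.filter_subset _ _)

/-- The members of `S` which meet `{1, ..., N}`. -/
def meeting (S : Set (Finset ℕ+)) (N : ℕ+) : Set (Finset ℕ+) := {F ∈ S | ∃ k ∈ F, k ≤ N}

/-- The members of `S` which lie to the right of `N`. -/
def tail (S : Set (Finset ℕ+)) (N : ℕ+) : Set (Finset ℕ+) := {F ∈ S | ∀ k ∈ F, N < k}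

theorem schreierSeminorm_le_sup (S : Set (Finset ℕ+)) (N : ℕ+) :
    schreierSeminorm S ≤ schreierSeminorm (meeting S N) ⊔ schreierSeminorm (tail S N) := by
  intro x
  rw [Seminorm.sup_apply]
  refine schreierSeminorm_le (le_max_of_le_left (apply_nonneg _ _)) fun F hF => ?_
  by_cases h : ∃ k ∈ F, k ≤ N
  · exact le_max_of_le_left (sum_le_schreierSeminorm (S := meeting S N) ⟨hF, h⟩ x)
  · push Not at h
    exact le_max_of_le_right (sum_le_schreierSeminorm (S := tail S N) ⟨hF, h⟩ x)

/-- The members of `S_α` which meet `{1, ..., N}` have a smaller complexity than `S_α` itself. -/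
theorem exists_schreierSeminorm_meeting_le (ha : IsApproximation a) {α : Ordinal.{0}}
    (hα : α < ω₁) (h0 : α ≠ 0) (N : ℕ+) :
    ∃ ξ < α, ∃ C ≥ 0, ∀ x, schreierSeminorm (meeting (family a α) N) x ≤
      C * schreierSeminorm (family a ξ) x := by
  induction α using Ordinal.limitRecOn with
  | zero => exact absurd rfl h0
  | add_one α _ =>
    refine ⟨α, Order.lt_add_one_iff.2 le_rfl, N, by positivity, fun x =>
      schreierSeminorm_le (by positivity) ?_⟩
    rintro F ⟨hF, k, hk, hkN⟩
    rw [family_add_one] at hF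
    obtain ⟨m, E, hE, hm, hlt, rfl⟩ := hF
    obtain ⟨i, -, hi⟩ := Finset.mem_biUnion.1 hk
    have hmN : (m : ℝ) ≤ N := by exact_mod_cast (hm i k hi).trans (PNat.coe_le_coe _ _ |>.2 hkN)
    have hdisj : Pairwise fun i j => Disjoint (E i) (E j) := fun i j hij =>
      Finset.disjoint_left.2 fun k hi hj => hij.lt_or_gt.elim
        (fun h => (hlt i j h k hi k hj).false) fun h => (hlt j i h k hj k hi).false
    calc ∑ n ∈ Finset.univ.biUnion E, |x n| = ∑ i, ∑ n ∈ E i, |x n| :=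
          Finset.sum_biUnion (hdisj.set_pairwise _)
      _ ≤ ∑ i : Fin m, schreierSeminorm (family a α) x :=
          Finset.sum_le_sum fun i _ => sum_le_schreierSeminorm (hE i) x
      _ = m * schreierSeminorm (family a α) x := by simp
      _ ≤ N * schreierSeminorm (family a α) x := by gcongr
  | limit β hl _ =>
    have hlt := ha.lt β hα hl
    choose C hC h using fun n : {n // n ≤ N} => exists_schreierSeminorm_le ha
      (ha.mono β hα hl n.2) ((hlt N).trans hα)
    refine ⟨a β N, hlt N, ∑ n ∈ (Finset.Icc 1 N).attach,
      C ⟨n.1, (Finset.mem_Icc.1 n.2).2⟩, Finset.sum_nonneg fun n _ => (hC _).le, fun x =>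
      schreierSeminorm_le (mul_nonneg (Finset.sum_nonneg fun n _ => (hC _).le)
        (apply_nonneg _ _)) ?_⟩
    rintro F ⟨hF, k, hk, hkN⟩
    rw [family_limit ha hα hl] at hF
    obtain ⟨n, hn, hF⟩ := hF
    have hnN := (hn k hk).trans hkN
    refine (sum_le_schreierSeminorm hF x).trans ((h ⟨n, hnN⟩ x).trans ?_)
    gcongr
    exact Finset.single_le_sum (f := fun n : {n // n ∈ Finset.Icc 1 N} =>
      C ⟨n.1, (Finset.mem_Icc.1 n.2).2⟩) (fun n _ => (hC _).le)
      (Finset.mem_attach _ ⟨n, Finset.mem_Icc.2 ⟨one_le, hnN⟩⟩)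

/-! ### The upper bound -/

theorem eq_sum_of_isLinearMap {f : (ℕ+ →₀ ℝ) → ℝ} (hf : IsLinearMap ℝ f) {s : Finset ℕ+}
    (hs : ∀ n ∉ s, f (Finsupp.single n 1) = 0) (x : ℕ+ →₀ ℝ) :
    f x = ∑ n ∈ s, x n * f (Finsupp.single n 1) := by
  have h1 : f x = x.sum fun n t => t * f (Finsupp.single n 1) := by
    conv_lhs => rw [← x.sum_single]
    change hf.mk' f _ = _
    rw [map_finsuppSum]
    refine Finsupp.sum_congr fun n _ => ?_
    rw [← smul_eq_mul, ← hf.map_smul, Finsupp.smul_single_one]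
    rfl
  rw [h1, Finsupp.sum, Finset.sum_subset (Finset.subset_union_left (s₂ := s)),
    ← Finset.sum_subset (Finset.subset_union_right (s₁ := x.support))]
  · intro n _ hn
    rw [hs n hn, mul_zero]
  · intro n _ hn
    rw [Finsupp.notMem_support_iff.1 hn, zero_mul]

/-- A dual ball of finite dimension vanishes after one derivation, because it is compact in norm. -/
theorem gaugeDeriv_functionals_eq_empty {p q : Seminorm ℝ (ℕ+ →₀ ℝ)} (hp : ∀ x n, |x n| ≤ p x)
    {s : Finset ℕ+} (hs : ∀ n ∉ s, q (Finsupp.single n 1) = 0) {η : ℝ} (hη : 0 < η) (r : ℝ) :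
    gaugeDeriv p η (functionals q r) = ∅ := by
  refine eq_empty_of_forall_notMem fun z hz => ?_
  have hU : IsOpen {u : (ℕ+ →₀ ℝ) → ℝ |
      ∑ n ∈ s, |u (Finsupp.single n 1) - z (Finsupp.single n 1)| < η / 2} :=
    isOpen_lt (by fun_prop) continuous_const
  obtain ⟨u, hu, v, hv, x, hx⟩ := hz.2 _ (hU.mem_nhds (by simpa using hη))
  have h0 : ∀ w ∈ functionals q r, ∀ n ∉ s, w (Finsupp.single n 1) = 0 := fun w hw n hn =>
    abs_eq_zero.1 (le_antisymm ((abs_le_of_mem_functionals hw _).trans_eq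
      (by rw [hs n hn, mul_zero])) (abs_nonneg _))
  rw [eq_sum_of_isLinearMap hu.2.1 (h0 u hu.2), eq_sum_of_isLinearMap hv.2.1 (h0 v hv.2),
    ← Finset.sum_sub_distrib] at hx
  refine hx.not_ge ?_
  calc ∑ n ∈ s, (x n * u (Finsupp.single n 1) - x n * v (Finsupp.single n 1))
      ≤ ∑ n ∈ s, p x * (|u (Finsupp.single n 1) - z (Finsupp.single n 1)| +
          |v (Finsupp.single n 1) - z (Finsupp.single n 1)|) := by
        refine Finset.sum_le_sum fun n _ => ?_
        rw [← mul_sub]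
        refine (le_abs_self _).trans ?_
        rw [abs_mul]
        refine mul_le_mul (hp x n) ?_ (abs_nonneg _) (apply_nonneg _ _)
        rw [abs_sub_comm (v _)]
        exact abs_sub_le _ _ _
    _ = p x * (∑ n ∈ s, |u (Finsupp.single n 1) - z (Finsupp.single n 1)| +
          ∑ n ∈ s, |v (Finsupp.single n 1) - z (Finsupp.single n 1)|) := by
        rw [← Finset.mul_sum, Finset.sum_add_distrib]
    _ ≤ p x * (η / 2 + η / 2) := by
        have h1 := (mem_ofPred_eq.mp hu.1).le
        have h2 := (mem_ofPred_eq.mp hv.1).le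
        gcongr
    _ = η * p x := by ring

theorem exists_transIter_family_eq_empty (ha : IsApproximation a) {α : Ordinal.{0}} (hα : α < ω₁)
    {ε : ℝ} (hε : 0 < ε) (r : ℝ) :
    ∃ m : ℕ, transIter (gaugeDeriv (schreierSeminorm (family a α)) ε)
      (functionals (schreierSeminorm (family a α)) r) (ω ^ α * m) = ∅ := by
  induction α using WellFoundedLT.induction generalizing ε r with
  | _ α ih =>
  have hp1 : ∀ (x : ℕ+ →₀ ℝ) n, |x n| ≤ schreierSeminorm (family a α) x :=
    fun x n => abs_le_schreierSeminorm (singleton_mem_family ha hα n) x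
  have hp : schreierSeminorm (family a α) ≠ 0 := by
    intro h
    have := hp1 (Finsupp.single 1 1) 1
    rw [h] at this
    norm_num at this
  refine exists_transIter_functionals_eq_empty hp (by positivity : 0 < ε / 8)
    (fun r hr => transIter_functionals_subset hε (fun x => ?_) hr) r
  obtain ⟨N, hN⟩ : ∃ N : ℕ+, ∀ n ∈ x.support, n ≤ N := x.support.exists_le
  refine ⟨schreierSeminorm (meeting (family a α) N), schreierSeminorm (tail (family a α) N),
    schreierSeminorm_mono (sep_subset _ _), schreierSeminorm_mono (sep_subset _ _),
    schreierSeminorm_le_sup _ N, schreierSeminorm_eq_zero fun F hF n hn => ?_, fun η hη r => ?_⟩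
  · by_contra h
    exact (hF.2 n hn).not_ge (hN n (Finsupp.mem_support_iff.2 h))
  rcases eq_or_ne α 0 with rfl | h0
  · rw [Ordinal.opow_zero, transIter_one (gaugeDeriv_mono _ _) (gaugeDeriv_subset _ _)]
    refine gaugeDeriv_functionals_eq_empty hp1 (s := Finset.Icc 1 N) (fun n hn =>
      schreierSeminorm_eq_zero ?_) hη r
    rintro F ⟨hF, k, hk, hkN⟩ l hl
    rw [family_zero] at hF
    rcases hF with ⟨n', rfl⟩ | rfl
    · rw [Finset.mem_singleton] at hk hl
      subst hk hl
      refine Finsupp.single_eq_of_ne ?_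
      rintro rfl
      exact hn (Finset.mem_Icc.2 ⟨one_le, hkN⟩)
    · simp at hk
  · obtain ⟨ξ, hξ, C, hC, hle⟩ := exists_schreierSeminorm_meeting_le ha hα h0 N
    obtain ⟨D, hD, hle'⟩ := exists_schreierSeminorm_le ha hξ.le hα
    obtain ⟨m, hm⟩ := ih ξ hξ (hξ.trans hα) (ε := η / D) (by positivity) (|r| * C)
    rw [← subset_empty_iff, ← hm]
    refine (transIter_gaugeDeriv_subset (fun x => ?_) (functionals_subset fun x => ?_) _).trans
      (transIter_antitone _ _ ?_)
    · rw [div_mul_eq_mul_div, div_le_iff₀ hD, mul_assoc, mul_comm _ D]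
      exact mul_le_mul_of_nonneg_left (hle' x) hη.le
    · rw [mul_assoc]
      exact mul_le_mul (le_abs_self r) (hle x) (apply_nonneg _ _) (abs_nonneg r)
    · calc ω ^ ξ * m ≤ ω ^ ξ * ω := by gcongr; exact (Ordinal.natCast_lt_omega0 m).le
        _ = ω ^ (ξ + 1) := by rw [Ordinal.opow_add, Ordinal.opow_one]
        _ ≤ ω ^ α := Ordinal.opow_le_opow_right Ordinal.omega0_pos (Order.add_one_le_iff.2 hξ)

end Schreier

namespace Schreier

open Set Szlenk Filter

/-! ### The lower bound -/

variable {a : Ordinal.{0} → ℕ+ → Ordinal.{0}}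

/-- The functional `x ↦ ∑ n ∈ F, x n` on `c₀₀`. -/
def sumOn (F : Finset ℕ+) (x : ℕ+ →₀ ℝ) : ℝ := ∑ n ∈ F, x n

theorem sumOn_empty : sumOn ∅ = 0 := by
  ext x
  simp [sumOn]

theorem tendsto_sumOn_singleton : Tendsto (fun k : ℕ+ => sumOn {k}) atTop (𝓝 0) := by
  refine tendsto_pi_nhds.2 fun x => tendsto_const_nhds.congr' ?_
  obtain ⟨N, hN⟩ := x.support.exists_le
  filter_upwards [eventually_gt_atTop N] with k hk
  have : x k = 0 := by
    by_contra h
    exact hk.not_ge (hN k (Finsupp.mem_support_iff.2 h))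
  simp [sumOn, this]

/-- The unions of `m` successive members of `S` lying to the right of `N`. -/
def successiveUnions (S : Set (Finset ℕ+)) (m : ℕ) (N : ℕ+) : Set (Finset ℕ+) :=
  {F | ∃ E : Fin m → Finset ℕ+, (∀ i, E i ∈ S) ∧ (∀ i, ∀ k ∈ E i, N < k) ∧
    (∀ i j, i < j → ∀ k ∈ E i, ∀ l ∈ E j, k < l) ∧ F = Finset.univ.biUnion E}

theorem union_mem_successiveUnions {S : Set (Finset ℕ+)} {m : ℕ} {N M : ℕ+} (hNM : N ≤ M)
    {E F : Finset ℕ+} (hE : E ∈ tail S N) (hEM : ∀ k ∈ E, k ≤ M)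
    (hF : F ∈ successiveUnions S m M) : E ∪ F ∈ successiveUnions S (m + 1) N := by
  obtain ⟨G, hG, hM, hlt, rfl⟩ := hF
  refine ⟨Fin.cons E G, Fin.cases hE.1 hG, Fin.cases hE.2 fun i k hk => hNM.trans_lt (hM i k hk),
    fun i j => ?_, ?_⟩
  · cases i using Fin.cases with
    | zero =>
      cases j using Fin.cases with
      | zero => exact fun h => absurd h (lt_irrefl _)
      | succ j => exact fun _ k hk l hl => (hEM k hk).trans_lt (hM j l hl)
    | succ i =>
      cases j using Fin.cases with
      | zero => exact fun h => absurd h (Fin.not_lt_zero _)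
      | succ j => exact fun h => hlt i j (Fin.succ_lt_succ_iff.1 h)
  · ext k
    simp [Fin.exists_fin_succ]

theorem disjoint_of_mem_successiveUnions {S : Set (Finset ℕ+)} {m : ℕ} {M : ℕ+}
    {E F : Finset ℕ+} (hEM : ∀ k ∈ E, k ≤ M) (hF : F ∈ successiveUnions S m M) : Disjoint E F := by
  obtain ⟨G, -, hM, -, rfl⟩ := hF
  refine Finset.disjoint_left.2 fun k hk hk' => ?_
  obtain ⟨i, -, hi⟩ := Finset.mem_biUnion.1 hk'
  exact (hEM k hk).not_gt (hM i k hi)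

/-- If `0` survives `γ` derivations of (the functionals of) every tail of `S`, then it survives
`γ * m` derivations of the unions of `m` members: with the first set kept fixed, the sets to the
right of it are derived away, and then the first set itself. -/
theorem zero_mem_transIter_successiveUnions {p : Seminorm ℝ (ℕ+ →₀ ℝ)} {ε : ℝ}
    {S : Set (Finset ℕ+)} {γ : Ordinal.{0}}
    (h : ∀ N, 0 ∈ transIter (gaugeDeriv p ε) (sumOn '' tail S N) γ) (m : ℕ) (N : ℕ+) :
    0 ∈ transIter (gaugeDeriv p ε) (sumOn '' successiveUnions S m N) (γ * m) := by
  induction m generalizing N with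
  | zero =>
    rw [Nat.cast_zero, mul_zero, transIter_zero]
    exact ⟨∅, ⟨Fin.elim0, fun i => i.elim0, fun i => i.elim0, fun i => i.elim0, by simp⟩,
      sumOn_empty⟩
  | succ m ih =>
    rw [Nat.cast_succ, mul_add_one, transIter_add]
    refine transIter_gaugeDeriv_subset (fun _ => le_rfl) ?_ γ (h N)
    rintro _ ⟨E, hE, rfl⟩
    obtain ⟨M, hM⟩ := (insert N E).exists_le
    have hEM : ∀ k ∈ E, k ≤ M := fun k hk => hM k (Finset.mem_insert_of_mem hk)
    have := transIter_gaugeDeriv_affine p ε (sumOn E) one_pos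
      (A' := sumOn '' successiveUnions S (m + 1) N) ?_ (γ * m) (ih M)
    · simpa using this
    · rintro _ ⟨F, hF, rfl⟩
      refine ⟨E ∪ F, union_mem_successiveUnions (hM N (Finset.mem_insert_self _ _)) hE hEM hF, ?_⟩
      ext x
      simp [sumOn, Finset.sum_union (disjoint_of_mem_successiveUnions hEM hF)]

/-- The tails of `S_α` survive `ω ^ α` derivations.  They are used, rather than `S_α` itself, to
make room for further sets on the left and to cut down at limit stages. -/
theorem zero_mem_transIter_tail (ha : IsApproximation a) {p : Seminorm ℝ (ℕ+ →₀ ℝ)}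
    (hp : ∀ n, p (Finsupp.single n 1) ≤ 1) {α : Ordinal.{0}} (hα : α < ω₁) (N : ℕ+) :
    0 ∈ transIter (gaugeDeriv p (1 / 2)) (sumOn '' tail (family a α) N) (ω ^ α) := by
  have h0 : ∀ (α : Ordinal.{0}), α < ω₁ → ∀ N, 0 ∈ sumOn '' tail (family a α) N := fun α hα N =>
    ⟨∅, ⟨empty_mem_family ha hα, by simp⟩, sumOn_empty⟩
  induction α using Ordinal.limitRecOn generalizing N with
  | zero =>
    rw [Ordinal.opow_zero, transIter_one (gaugeDeriv_mono _ _) (gaugeDeriv_subset _ _)]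
    refine ⟨h0 0 hα N, fun U hU => ?_⟩
    obtain ⟨k, hkU, hkN⟩ := ((tendsto_sumOn_singleton.eventually_mem hU).and
      (eventually_gt_atTop N)).exists
    refine ⟨_, ⟨hkU, {k}, ⟨singleton_mem_family ha hα k, by simpa using hkN⟩, rfl⟩, 0,
      ⟨mem_of_mem_nhds hU, h0 0 hα N⟩, Finsupp.single k 1, ?_⟩
    have := hp k
    simp only [sumOn, Finset.sum_singleton, Finsupp.single_eq_same, Pi.zero_apply]
    linarith
  | add_one α ih =>
    have hα' : α < ω₁ := (Order.lt_add_one_iff.2 le_rfl).trans hα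
    rw [mem_transIter]
    refine ⟨h0 _ hα N, fun δ hδ => ?_⟩
    rw [Ordinal.opow_add, Ordinal.opow_one, Ordinal.lt_mul_iff_of_isSuccLimit
      Ordinal.isSuccLimit_omega0] at hδ
    obtain ⟨c, hc, hδ⟩ := hδ
    obtain ⟨m, rfl⟩ := Ordinal.lt_omega0.1 hc
    obtain ⟨M, hM⟩ : ∃ M : ℕ+, m ≤ (M : ℕ) := ⟨m.succPNat, by simp⟩
    refine (mem_transIter.1 (transIter_gaugeDeriv_subset (fun _ => le_rfl) (image_mono ?_) _
      (zero_mem_transIter_successiveUnions (fun N => ih hα' N) m (max M N)))).2 δ hδ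
    rintro F ⟨E, hE, hk, hlt, rfl⟩
    refine ⟨?_, fun k hkF => ?_⟩
    · rw [family_add_one]
      exact ⟨m, E, hE, fun i k hki => hM.trans ((le_max_left M N).trans (hk i k hki).le), hlt, rfl⟩
    · obtain ⟨i, -, hi⟩ := Finset.mem_biUnion.1 hkF
      exact (le_max_right M N).trans_lt (hk i k hi)
  | limit β hl ih =>
    rw [mem_transIter]
    refine ⟨h0 _ hα N, fun δ hδ => ?_⟩
    rw [Ordinal.lt_opow_of_isSuccLimit Ordinal.omega0_ne_zero hl] at hδ
    obtain ⟨ξ, hξ, hδ⟩ := hδ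
    obtain ⟨n, hn⟩ := exists_lt_approximation ha hα hl hξ
    have hnβ := ha.lt β hα hl n
    refine (mem_transIter.1 (transIter_gaugeDeriv_subset (fun _ => le_rfl) (image_mono ?_) _
      (ih _ hnβ (hnβ.trans hα) (max n N)))).2 δ
      (hδ.trans_le (Ordinal.opow_le_opow_right Ordinal.omega0_pos hn.le))
    rintro F ⟨hF, hk⟩
    refine ⟨?_, fun k hkF => (le_max_right n N).trans_lt (hk k hkF)⟩
    rw [family_limit ha hα hl]
    exact ⟨n, fun k hkF => (le_max_left n N).trans (hk k hkF).le, hF⟩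

theorem schreierSeminorm_single_le {α : Ordinal.{0}} (n : ℕ+) :
    schreierSeminorm (family a α) (Finsupp.single n 1) ≤ 1 := by
  refine schreierSeminorm_le zero_le_one fun F _ => ?_
  rw [Finset.sum_congr rfl fun k _ => (show |Finsupp.single n (1 : ℝ) k| = if n = k then 1 else 0 by
    rw [Finsupp.single_apply]; split_ifs <;> simp)]
  rw [Finset.sum_ite_eq]
  split_ifs <;> simp

theorem zero_mem_transIter_functionals (ha : IsApproximation a) {α : Ordinal.{0}} (hα : α < ω₁)
    {N : ℕ} (hN : N ≠ 0) :
    0 ∈ transIter (gaugeDeriv (schreierSeminorm (family a α)) ((N : ℝ)⁻¹ * (1 / 2)))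
      (functionals (schreierSeminorm (family a α)) 1) (ω ^ α * N) := by
  refine zero_mem_transIter_mul (transIter_gaugeDeriv_subset (fun _ => le_rfl) ?_ _
    (zero_mem_transIter_tail ha (schreierSeminorm_single_le) hα 1)) hN
  rintro _ ⟨F, hF, rfl⟩
  refine ⟨⟨fun x y => ?_, fun c x => ?_⟩, fun x => ?_⟩
  · simp [sumOn, Finset.sum_add_distrib]
  · simp [sumOn, Finset.mul_sum]
  · rw [one_mul]
    exact (Finset.sum_le_sum fun n _ => le_abs_self _).trans (sum_le_schreierSeminorm hF.1 x)

end Schreier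

namespace Szlenk

open Set Filter

/-! ### From the weak* dual to functions on a dense subspace -/

section Transfer

theorem iterDeriv_eq_transIter {X : Type*} [NormedAddCommGroup X] [NormedSpace ℝ X]
    (K : Set (WeakDual ℝ X)) (ε : ℝ) (γ : Ordinal.{0}) :
    iterDeriv K ε γ = transIter (deriv ε) K γ := by
  have hd : Monotone (deriv (X := X) ε) := fun A B h z hz => ⟨h hz.1, fun U hU =>
    (hz.2 U hU).trans_le (Metric.ediam_mono (image_mono (inter_subset_inter_right _ h)))⟩
  have hd' : ∀ A, deriv (X := X) ε A ⊆ A := fun A z hz => hz.1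
  induction γ using Ordinal.limitRecOn with
  | zero => rw [iterDeriv_zero, transIter_zero]
  | add_one γ ih => rw [iterDeriv_add_one, transIter_add_one hd hd', ih]
  | limit γ hl ih =>
    rw [iterDeriv_limit K ε hl]
    ext z
    simp only [mem_iInter, mem_transIter]
    constructor
    · refine fun h => ⟨?_, fun δ hδ => ?_⟩
      · have := h 0 hl.bot_lt
        rwa [iterDeriv_zero] at this
      · have := h (δ + 1) (hl.add_one_lt hδ)
        rwa [ih _ (hl.add_one_lt hδ), transIter_add_one hd hd'] at this
    · intro h δ hδ
      rw [ih δ hδ]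
      exact mem_transIter.2 ⟨h.1, fun η hη => h.2 η (hη.trans hδ)⟩

variable {E X : Type*} [AddCommGroup E] [Module ℝ E] [NormedAddCommGroup X] [NormedSpace ℝ X]
  {e : E →ₗ[ℝ] X} {p : Seminorm ℝ E}

/-- The restriction of functionals on `X` to the subspace `e : E → X`. -/
def restrict (e : E →ₗ[ℝ] X) (f : WeakDual ℝ X) (x : E) : ℝ := f (e x)

theorem continuous_restrict (e : E →ₗ[ℝ] X) : Continuous (restrict e) :=
  continuous_pi fun x => WeakDual.eval_continuous (e x)

theorem restrict_injective (he : DenseRange e) : Function.Injective (restrict e) := by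
  intro f g h
  have : (f : X → ℝ) = g := he.equalizer f.continuous g.continuous h
  exact DFunLike.coe_injective this

theorem mapsTo_restrict (hp : ∀ x, p x = ‖e x‖) :
    MapsTo (restrict e) (dualBall X) (functionals p 1) := by
  refine fun f hf => ⟨⟨fun x y => ?_, fun c x => ?_⟩, fun x => ?_⟩
  · simp [restrict]
  · simp [restrict]
  · rw [hp]
    exact (le_abs_self _).trans (ContinuousLinearMap.le_of_opNorm_le
      (WeakDual.toStrongDual f) (mem_closedBall_zero_iff.1 hf) (e x))

theorem surjOn_restrict (he : DenseRange e) (hp : ∀ x, p x = ‖e x‖) :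
    SurjOn (restrict e) (dualBall X) (functionals p 1) := by
  intro g hg
  have hbound : ∀ x, ‖hg.1.mk' g x‖ ≤ 1 * ‖e x‖ := fun x => by
    rw [← hp]
    exact abs_le_of_mem_functionals hg x
  refine ⟨StrongDual.toWeakDual ((hg.1.mk' g).extendOfNorm e),
    mem_closedBall_zero_iff.2 (LinearMap.opNorm_extendOfNorm_le he zero_le_one hbound), ?_⟩
  ext x
  exact LinearMap.extendOfNorm_eq he ⟨1, hbound⟩ x

theorem ofReal_lt_edist_iff (he : DenseRange e) (hp : ∀ x, p x = ‖e x‖) {ε : ℝ} (hε : 0 ≤ ε)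
    (u v : WeakDual ℝ X) :
    ENNReal.ofReal ε < edist (WeakDual.toStrongDual u) (WeakDual.toStrongDual v) ↔
      ∃ x, ε * p x < restrict e u x - restrict e v x := by
  rw [edist_dist, ENNReal.ofReal_lt_ofReal_iff_of_nonneg hε, dist_eq_norm, ← map_sub]
  set g : StrongDual ℝ X := WeakDual.toStrongDual (u - v) with hg
  have hgx : ∀ x, restrict e u x - restrict e v x = g (e x) := fun x => rfl
  simp only [hgx, hp]
  constructor
  · intro h
    have h1 : ∃ y, ε * ‖y‖ < ‖g y‖ := by
      by_contra! h'
      exact h.not_ge (g.opNorm_le_bound hε h')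
    have h2 : IsOpen {y : X | ε * ‖y‖ < ‖g y‖} := isOpen_lt (by fun_prop) (by fun_prop)
    obtain ⟨x, hx⟩ := he.exists_mem_open h2 h1
    rcases lt_abs.1 (mem_ofPred_eq.mp hx) with h3 | h3
    · exact ⟨x, h3⟩
    · exact ⟨-x, by simpa using h3⟩
  · rintro ⟨x, hx⟩
    by_contra! h
    exact hx.not_ge ((le_abs_self _).trans (g.le_of_opNorm_le h (e x)))

theorem restrict_mem_transIter_iff (he : DenseRange e) (hp : ∀ x, p x = ‖e x‖) {ε : ℝ}
    (hε : 0 ≤ ε) (γ : Ordinal.{0}) {f : WeakDual ℝ X} (hf : f ∈ dualBall X) :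
    restrict e f ∈ transIter (gaugeDeriv p ε) (functionals p 1) γ ↔
      f ∈ iterDeriv (dualBall X) ε γ := by
  rw [iterDeriv_eq_transIter]
  induction γ using WellFoundedLT.induction generalizing f with
  | _ γ ih =>
  rw [mem_transIter, mem_transIter]
  refine and_congr (iff_of_true (mapsTo_restrict hp hf) hf) (forall₂_congr fun δ hδ => ?_)
  refine and_congr (ih δ hδ hf) ?_
  have hlt : ∀ A : Set (WeakDual ℝ X),
      ENNReal.ofReal ε < Metric.ediam (WeakDual.toStrongDual '' A) ↔
        ∃ u ∈ A, ∃ v ∈ A, ∃ x, ε * p x < restrict e u x - restrict e v x := fun A => by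
    rw [← not_le, Metric.ediam_image_le_iff]
    push Not
    simp only [ofReal_lt_edist_iff he hp hε]
  simp only [hlt]
  constructor
  · intro h U hU
    -- on the compact ball, the weak* topology is induced by `restrict`
    have : CompactSpace (dualBall X) :=
      isCompact_iff_compactSpace.1 (WeakDual.isCompact_closedBall 0 1)
    have hemb : Topology.IsClosedEmbedding fun g : dualBall X => restrict e g.1 :=
      ((continuous_restrict e).comp continuous_subtype_val).isClosedEmbedding
        ((restrict_injective he).comp Subtype.val_injective)
    have hU' : (Subtype.val ⁻¹' U : Set (dualBall X)) ∈ 𝓝 ⟨f, hf⟩ :=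
      continuous_subtype_val.continuousAt.preimage_mem_nhds hU
    rw [hemb.isInducing.nhds_eq_comap] at hU'
    obtain ⟨W, hW, hWU⟩ := hU'
    obtain ⟨u, ⟨huW, huT⟩, v, ⟨hvW, hvT⟩, hx⟩ := h W hW
    obtain ⟨u, hu, rfl⟩ := surjOn_restrict he hp (transIter_subset _ _ _ huT)
    obtain ⟨v, hv, rfl⟩ := surjOn_restrict he hp (transIter_subset _ _ _ hvT)
    exact ⟨u, ⟨hWU (a := ⟨u, hu⟩) huW, (ih δ hδ hu).1 huT⟩, v,
      ⟨hWU (a := ⟨v, hv⟩) hvW, (ih δ hδ hv).1 hvT⟩, hx⟩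
  · intro h W hW
    obtain ⟨u, hu, v, hv, hx⟩ := h _ ((continuous_restrict e).continuousAt.preimage_mem_nhds hW)
    exact ⟨_, ⟨hu.1, (ih δ hδ (transIter_subset _ _ _ hu.2)).2 hu.2⟩, _,
      ⟨hv.1, (ih δ hδ (transIter_subset _ _ _ hv.2)).2 hv.2⟩, hx⟩

theorem iterDeriv_eq_empty_iff (he : DenseRange e) (hp : ∀ x, p x = ‖e x‖) {ε : ℝ} (hε : 0 ≤ ε)
    (γ : Ordinal.{0}) :
    iterDeriv (dualBall X) ε γ = ∅ ↔ transIter (gaugeDeriv p ε) (functionals p 1) γ = ∅ := by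
  constructor <;> intro h <;> refine eq_empty_of_forall_notMem fun f hf => ?_
  · obtain ⟨f, hfb, rfl⟩ := surjOn_restrict he hp (transIter_subset _ _ _ hf)
    exact notMem_empty f (h ▸ (restrict_mem_transIter_iff he hp hε γ hfb).1 hf)
  · have hfb : f ∈ dualBall X := by
      rw [iterDeriv_eq_transIter] at hf
      exact transIter_subset _ _ _ hf
    exact notMem_empty _ (h ▸ (restrict_mem_transIter_iff he hp hε γ hfb).2 hf)

theorem eta_le {K : Set (WeakDual ℝ X)} {ε : ℝ} {γ : Ordinal.{0}} (hγ : γ < ω₁)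
    (h : iterDeriv K ε γ = ∅) : eta K ε ≤ γ := by
  rw [eta, if_pos ⟨γ, hγ, h⟩]
  exact csInf_le' h

theorem lt_eta {K : Set (WeakDual ℝ X)} {ε : ℝ} {γ : Ordinal.{0}} (hγ : γ < ω₁)
    (h : iterDeriv K ε γ ≠ ∅) : γ < eta K ε := by
  rw [eta]
  split_ifs with h'
  · obtain ⟨δ, -, hδ⟩ := h'
    by_contra! hle
    have hmem := csInf_mem (s := {γ | iterDeriv K ε γ = ∅}) ⟨δ, hδ⟩
    refine h (subset_empty_iff.1 (Subset.trans ?_ (mem_ofPred_eq.mp hmem).subset))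
    rw [iterDeriv_eq_transIter, iterDeriv_eq_transIter]
    exact transIter_antitone _ _ hle
  · exact hγ

end Transfer

end Szlenk

namespace Schreier

open Set Szlenk

theorem iterDeriv_dualBall_eq_empty_iff (a : Ordinal.{0} → ℕ+ → Ordinal.{0}) (α : Ordinal.{0})
    {ε : ℝ} (hε : 0 ≤ ε) (γ : Ordinal.{0}) :
    iterDeriv (dualBall (Space a α)) ε γ = ∅ ↔
      transIter (gaugeDeriv (schreierSeminorm (family a α)) ε)
        (functionals (schreierSeminorm (family a α)) 1) γ = ∅ :=
  let e : C00 (family a α) →ₗ[ℝ] Space a α :=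
    (UniformSpace.Completion.toComplL (𝕜 := ℝ) (E := C00 (family a α))).toLinearMap
  iterDeriv_eq_empty_iff (E := ℕ+ →₀ ℝ) (e := e)
    (UniformSpace.Completion.denseRange_coe (α := C00 (family a α)))
    (fun x => (UniformSpace.Completion.norm_coe (show C00 (family a α) from x)).symm) hε γ

end Schreier

end

theorem proposition4p6 (a : Ordinal.{0} → ℕ+ → Ordinal.{0}) (ha : Schreier.IsApproximation a)
    (α : Ordinal.{0}) (hα : α < ω₁) :
    Szlenk.index (Schreier.Space a α) = ω ^ (α + 1) := by
  have hω : ω ^ α * ω = ω ^ (α + 1) := by rw [Ordinal.opow_add, Ordinal.opow_one]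
  have hlt : ∀ m : ℕ, ω ^ α * m < ω ^ (α + 1) := fun m => by
    rw [← hω]
    exact mul_lt_mul_of_pos_left (Ordinal.natCast_lt_omega0 m)
      (Ordinal.opow_pos _ Ordinal.omega0_pos)
  have hω₁ : ω ^ (α + 1) < ω₁ :=
    Ordinal.isPrincipal_opow_omega 1 Ordinal.omega0_lt_omega_one
      ((Cardinal.isSuccLimit_omega 1).add_one_lt hα)
  have hle : ∀ ε : {ε : ℝ // 0 < ε},
      Szlenk.eta (Szlenk.dualBall (Schreier.Space a α)) ε.1 ≤ ω ^ (α + 1) := fun ε => by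
    obtain ⟨m, hm⟩ := Schreier.exists_transIter_family_eq_empty ha hα ε.2 1
    exact (Szlenk.eta_le ((hlt m).trans hω₁)
      ((Schreier.iterDeriv_dualBall_eq_empty_iff a α ε.2.le _).2 hm)).trans (hlt m).le
  have : Nonempty {ε : ℝ // 0 < ε} := ⟨⟨1, one_pos⟩⟩
  refine le_antisymm (ciSup_le hle) (le_of_forall_lt fun δ hδ => ?_)
  rw [← hω, Ordinal.lt_mul_iff_of_isSuccLimit Ordinal.isSuccLimit_omega0] at hδ
  obtain ⟨c, hc, hδ⟩ := hδ
  obtain ⟨m, rfl⟩ := Ordinal.lt_omega0.1 hc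
  have hm : m ≠ 0 := by
    rintro rfl
    simp at hδ
  refine (hδ.trans (Szlenk.lt_eta ((hlt m).trans hω₁) fun h => ?_)).trans_le
    (le_ciSup ⟨_, Set.forall_mem_range.2 hle⟩ ⟨(m : ℝ)⁻¹ * (1 / 2), by positivity⟩)
  rw [Schreier.iterDeriv_dualBall_eq_empty_iff a α (by positivity)] at h
  exact Set.notMem_empty _ (h ▸ Schreier.zero_mem_transIter_functionals ha hα hm)
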